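/- There is an absolute constant $C>0$ such that the following holds for all integers $n\ge 0$, $\ell\ge 1$ and all real $\varepsilon\in(0,1/2)$. Consider the online $k$-way partitioning problem with $\ell$ bins, each of capacity $(1+\varepsilon)n/\ell$. Initially there are $n$ integers, all equal to $1$, each assigned to one of the bins so that the load of every bin (the sum of the integers assigned to it) is at most its capacity. An adversary then reveals requests one at a time; each request names two different integers $a,b$ that are currently present, and they are replaced by the single integer $a+b$. It is assumed that initially and after each addition the present integers can be assigned to the bins such that every bin has load exactly $n/\ell$, and that at the end of the request sequence there are exactly $\ell$ integers, each equal to $n/\ell$. To serve a request, an algorithm may reassign integers to bins, must bring the two summands into the same bin (where their sum is then placed), and must keep the load of every bin at most $(1+\varepsilon)n/\ell$ after each addition. Its cost is the sum, over all requests, of the values (before the addition) of the integers whose bin changes. Then there is a deterministic online algorithm for this problem (it may depend on $n,\ell,\varepsilon$; each of its assignments depends only on the initial assignment and the requests revealed so far) such that for every initial assignment and every request sequence $\sigma$ as above it serves $\sigma$ with all capacities respected, and $$\mathrm{ALG}(\sigma)\;\le\; C\cdot\frac{\ell\,\log_2 n\,\log_2 \ell}{\varepsilon}\cdot \mathrm{OFF}(\sigma),$$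 where $\mathrm{ALG}(\sigma)$ is its cost and $\mathrm{OFF}(\sigma)$ is the minimum cost of serving $\sigma$, from the same initial assignment and under the same rules, when $\sigma$ is known in advance. That is, the algorithm is strictly $O((\ell\log n\log\ell)/\varepsilon)$-competitive. (For $n<\ell$ there are no admissible request sequences and the claim is void.) -/

import Mathlib

namespace OnlineKWay

/-- The integers are named by `Fin n`. A valuation records the current value of each of them;
value `0` means that the integer has been absorbed by an earlier addition and is no longer
present. -/
abbrev Valuation (n : ℕ) := Fin n → ℕ

/-- An assignment of the integers to the `ℓ` bins. -/
abbrev Assignment (n ℓ : ℕ) := Fin n → Fin ℓ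

/-- A request `(i, j)` asks to add the integers named `i` and `j`. -/
abbrev Request (n : ℕ) := Fin n × Fin n

/-- Perform an addition: the sum keeps the name of the first summand, the second one
disappears. -/
def addStep {n : ℕ} (w : Valuation n) (r : Request n) : Valuation n :=
  Function.update (Function.update w r.1 (w r.1 + w r.2)) r.2 0

/-- The values after the additions in `σ`, when all `n` integers are `1` at the start. -/
def valuesAfter {n : ℕ} (σ : List (Request n)) : Valuation n :=
  σ.foldl addStep (fun _ => 1)

/-- The load of bin `b`: the sum of the integers assigned to it. -/
def load {n ℓ : ℕ} (w : Valuation n) (a : Assignment n ℓ) (b : Fin ℓ) : ℕ :=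
  ∑ i ∈ Finset.univ.filter (fun i => a i = b), w i

/-- Every bin has load at most `(1 + ε) n / ℓ`. -/
def WithinCapacity {n ℓ : ℕ} (ε : ℝ) (w : Valuation n) (a : Assignment n ℓ) : Prop :=
  ∀ b, (load w a b : ℝ) ≤ (1 + ε) * n / ℓ

/-- The sum of the integers that are moved when passing from `a` to `a'`. -/
def moveCost {n ℓ : ℕ} (w : Valuation n) (a a' : Assignment n ℓ) : ℕ :=
  ∑ i ∈ Finset.univ.filter (fun i => a i ≠ a' i), w i

/-- The request sequences that the adversary may pose. -/
structure IsRequestSequence {n : ℕ} (ℓ : ℕ) (σ : List (Request n)) : Prop where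
  /-- Each request names two different integers that are present. -/
  legal : ∀ (t : ℕ) (ht : t < σ.length),
    σ[t].1 ≠ σ[t].2 ∧ 0 < valuesAfter (σ.take t) σ[t].1 ∧ 0 < valuesAfter (σ.take t) σ[t].2
  /-- At all times the integers can be distributed such that all bins have load `n / ℓ`. -/
  balanced : ∀ t ≤ σ.length, ∃ a : Assignment n ℓ,
    ∀ b, (load (valuesAfter (σ.take t)) a b : ℝ) = (n : ℝ) / ℓ
  /-- At the end there are `ℓ` integers. -/
  final_card : (Finset.univ.filter (fun i => 0 < valuesAfter σ i)).card = ℓ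
  /-- At the end each integer is `n / ℓ`. -/
  final_value : ∀ i, 0 < valuesAfter σ i → (valuesAfter σ i : ℝ) = (n : ℝ) / ℓ

/-- `a t` is the assignment after the first `t` additions. To serve request number `t` one
reassigns integers from `a t` to `a (t + 1)`, which must put the two summands into the same bin,
and then adds these two. After each addition all capacities must be respected. -/
structure IsSchedule {n ℓ : ℕ} (ε : ℝ) (init : Assignment n ℓ) (σ : List (Request n))
    (a : ℕ → Assignment n ℓ) : Prop where
  start : a 0 = init
  together : ∀ (t : ℕ) (ht : t < σ.length), a (t + 1) σ[t].1 = a (t + 1) σ[t].2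
  capacity : ∀ t ≤ σ.length, WithinCapacity ε (valuesAfter (σ.take t)) (a t)

/-- The cost of a schedule: the sum of all numbers moved while serving `σ`. -/
def scheduleCost {n ℓ : ℕ} (σ : List (Request n)) (a : ℕ → Assignment n ℓ) : ℕ :=
  ∑ t ∈ Finset.range σ.length, moveCost (valuesAfter (σ.take t)) (a t) (a (t + 1))

/-- The cost of an optimal offline algorithm, which knows `σ` in advance. -/
noncomputable def offlineCost {n ℓ : ℕ} (ε : ℝ) (init : Assignment n ℓ)
    (σ : List (Request n)) : ℕ :=
  sInf {c | ∃ a : ℕ → Assignment n ℓ, IsSchedule ε init σ a ∧ scheduleCost σ a = c}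

/-- A (deterministic) online algorithm determines the current assignment from the initial
assignment and the requests revealed so far. -/
abbrev OnlineAlgorithm (n ℓ : ℕ) := Assignment n ℓ → List (Request n) → Assignment n ℓ

/-- The assignments that an online algorithm produces on the prefixes of `σ`. -/
def OnlineAlgorithm.run {n ℓ : ℕ} (A : OnlineAlgorithm n ℓ) (init : Assignment n ℓ)
    (σ : List (Request n)) : ℕ → Assignment n ℓ :=
  fun t => A init (σ.take t)

/-- `A` solves the online problem with bins of capacity `(1 + ε) n / ℓ` and is (strictly)
`c`-competitive, from every initial assignment that respects the capacities. -/
def IsCompetitive {n ℓ : ℕ} (ε : ℝ) (A : OnlineAlgorithm n ℓ) (c : ℝ) : Prop :=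
  ∀ init : Assignment n ℓ, WithinCapacity ε (fun _ => 1) init →
    ∀ σ : List (Request n), IsRequestSequence ℓ σ →
      IsSchedule ε init σ (A.run init σ) ∧
        (scheduleCost σ (A.run init σ) : ℝ) ≤ c * offlineCost ε init σ

end OnlineKWay

/-! Regard an integer of value w as a block of w units. Assignments become maps on units that are
constant on blocks, and moving costs become Hamming distances. Let Δ be the distance from the
initial assignment to the final assignment of an optimal schedule. Two final integers exceed a
capacity, so this assignment is perfectly balanced, and OFF ≥ Δ (`IsSchedule.exists_isTarget`). As
blocks only grow, it is a valid balanced target at all earlier times too.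

The lazy rule moves the smaller summand to the larger one and returns a sum that comes mostly from
one bin to that bin. Joining is charged to the units displaced by the target, each of which gains at
most log n in potential, so the total cost is O(Δ log n) (`lazyRun_cost_le`). The lazy assignment
also stays within distance 4Δ of the initial one, hence loads are at most n/ℓ + 5Δ
(`unitLoad_lazyRun_le`).

If the lazy rule ever violates a capacity, then Δ > εn/(5ℓ), so n is O(Δℓ/ε) and costs of order n
log n are affordable. From then on the rebalancing rule is followed. Merging costs O(n log n) in
total, each rebalancing costs O(Δ) in the amortized sense, and between two of them the potential
over all units grows by εn/ℓ, so there are O((ℓ/ε) log n) of them (`exists_rebalanceRun_bound`). The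
factor log ℓ is needed only through log ℓ ≥ 1 when ℓ ≥ 2. -/

namespace OnlineKWay

open Finset

variable {n ℓ : ℕ}

/-! ### Integers as blocks of units -/

/-- The effect of an addition on the map sending each unit to the integer that contains it. -/
def mergeRep (ρ : Fin n → Fin n) (r : Request n) : Fin n → Fin n :=
  fun v => if ρ v = r.2 then r.1 else ρ v

/-- The map sending each unit to the name of the integer that contains it after `σ`. -/
def rep (σ : List (Request n)) : Fin n → Fin n :=
  σ.foldl mergeRep id

/-- The units contained in the integer named `x`. -/
def cls (ρ : Fin n → Fin n) (x : Fin n) : Finset (Fin n) :=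
  univ.filter (fun v => ρ v = x)

/-- The request names two different integers that are present. -/
structure LegalRequest (ρ : Fin n → Fin n) (r : Request n) : Prop where
  idem : ∀ v, ρ (ρ v) = ρ v
  ne : r.1 ≠ r.2
  fst : ρ r.1 = r.1
  snd : ρ r.2 = r.2

/-- An assignment of the units that keeps all units of an integer together. -/
def Respects (ρ : Fin n → Fin n) (a : Assignment n ℓ) : Prop :=
  ∀ u v, ρ u = ρ v → a u = a v

lemma mem_cls {ρ : Fin n → Fin n} {x v : Fin n} : v ∈ cls ρ x ↔ ρ v = x := by
  simp [cls]

lemma rep_append_singleton (σ : List (Request n)) (r : Request n) :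
    rep (σ ++ [r]) = mergeRep (rep σ) r := by
  simp [rep, List.foldl_append]

lemma valuesAfter_append_singleton (σ : List (Request n)) (r : Request n) :
    valuesAfter (σ ++ [r]) = addStep (valuesAfter σ) r := by
  simp [valuesAfter, List.foldl_append]

lemma mergeRep_respects {ρ : Fin n → Fin n} {r : Request n} {u v : Fin n} (h : ρ u = ρ v) :
    mergeRep ρ r u = mergeRep ρ r v := by
  simp [mergeRep, h]

lemma rep_append_eq_of_eq (σ τ : List (Request n)) {u v : Fin n} (h : rep σ u = rep σ v) :
    rep (σ ++ τ) u = rep (σ ++ τ) v := by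
  induction τ using List.reverseRecOn with
  | nil => simpa using h
  | append_singleton τ r ih =>
    rw [← List.append_assoc, rep_append_singleton]
    exact mergeRep_respects ih

lemma mergeRep_idem {ρ : Fin n → Fin n} {r : Request n} (h : LegalRequest ρ r) (v : Fin n) :
    mergeRep ρ r (mergeRep ρ r v) = mergeRep ρ r v := by
  have h1 := h.ne
  have h2 := h.fst
  have h3 := h.idem v
  unfold mergeRep
  split_ifs <;> grind

lemma cls_mergeRep_fst {ρ : Fin n → Fin n} {r : Request n} :
    cls (mergeRep ρ r) r.1 = cls ρ r.1 ∪ cls ρ r.2 := by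
  ext v
  simp only [mem_union, mem_cls, mergeRep]
  split_ifs <;> grind

lemma cls_mergeRep_snd {ρ : Fin n → Fin n} {r : Request n} (h : r.1 ≠ r.2) :
    cls (mergeRep ρ r) r.2 = ∅ := by
  ext v
  simp only [mem_cls, mergeRep, notMem_empty, iff_false]
  split_ifs <;> grind

lemma cls_mergeRep_of_ne {ρ : Fin n → Fin n} {r : Request n} {x : Fin n} (h1 : x ≠ r.1)
    (h2 : x ≠ r.2) : cls (mergeRep ρ r) x = cls ρ x := by
  ext v
  simp only [mem_cls, mergeRep]
  split_ifs <;> grind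

lemma disjoint_cls {ρ : Fin n → Fin n} {x y : Fin n} (h : x ≠ y) :
    Disjoint (cls ρ x) (cls ρ y) := by
  rw [Finset.disjoint_left]
  intro v hx hy
  rw [mem_cls] at hx hy
  exact h (hx ▸ hy)

lemma card_cls_mergeRep_fst {ρ : Fin n → Fin n} {r : Request n} (h : r.1 ≠ r.2) :
    #(cls (mergeRep ρ r) r.1) = #(cls ρ r.1) + #(cls ρ r.2) := by
  rw [cls_mergeRep_fst, card_union_of_disjoint (disjoint_cls h)]

lemma card_cls_pos (ρ : Fin n → Fin n) (v : Fin n) : 0 < #(cls ρ (ρ v)) :=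
  card_pos.2 ⟨v, mem_cls.2 rfl⟩

/-- Units of the same integer after a sequence of requests, and the values, are described by `rep`. -/
lemma valuesAfter_eq_card_cls {σ : List (Request n)}
    (h : ∀ (t : ℕ) (ht : t < σ.length), σ[t].1 ≠ σ[t].2) (x : Fin n) :
    valuesAfter σ x = #(cls (rep σ) x) := by
  induction σ using List.reverseRecOn generalizing x with
  | nil =>
    have : cls (rep ([] : List (Request n))) x = {x} := by
      ext v
      simp [mem_cls, rep]
    simp [valuesAfter, this]
  | append_singleton σ r ih =>
    have ih := ih (fun t ht => by
      have := h t (by simp; omega)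
      rwa [List.getElem_append_left ht] at this)
    have hr : r.1 ≠ r.2 := by
      have := h σ.length (by simp)
      simpa using this
    rw [valuesAfter_append_singleton, rep_append_singleton]
    unfold addStep
    by_cases h2 : x = r.2
    · subst h2
      simp [cls_mergeRep_snd hr]
    · rw [Function.update_of_ne h2]
      by_cases h1 : x = r.1
      · subst h1
        rw [Function.update_self, card_cls_mergeRep_fst hr, ih, ih]
      · rw [Function.update_of_ne h1, cls_mergeRep_of_ne h1 h2, ih]

section Sequences

variable {σ : List (Request n)}

lemma take_succ_eq {t : ℕ} (ht : t < σ.length) : σ.take (t + 1) = σ.take t ++ [σ[t]] := by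
  simp [List.take_append_getElem]

lemma rep_take_succ {t : ℕ} (ht : t < σ.length) :
    rep (σ.take (t + 1)) = mergeRep (rep (σ.take t)) σ[t] := by
  rw [take_succ_eq ht, rep_append_singleton]

lemma IsRequestSequence.valuesAfter_take (hσ : IsRequestSequence ℓ σ) (t : ℕ) (x : Fin n) :
    valuesAfter (σ.take t) x = #(cls (rep (σ.take t)) x) := by
  apply valuesAfter_eq_card_cls
  intro k hk
  simp only [List.getElem_take]
  exact (hσ.legal k (by simp at hk; omega)).1

lemma IsRequestSequence.rep_idem (hσ : IsRequestSequence ℓ σ) {t : ℕ} (ht : t ≤ σ.length)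
    (v : Fin n) : rep (σ.take t) (rep (σ.take t) v) = rep (σ.take t) v := by
  induction t generalizing v with
  | zero => simp [rep]
  | succ t ih =>
    have ih := ih (by omega)
    -- A positive value means a nonempty block, so the name lies in the image of `rep`, which
    -- idempotence fixes.
    have hfix : ∀ x, 0 < valuesAfter (σ.take t) x → rep (σ.take t) x = x := by
      intro x hx
      rw [hσ.valuesAfter_take, card_pos] at hx
      obtain ⟨u, hu⟩ := hx
      rw [mem_cls] at hu
      rw [← hu, ih]
    have hl := hσ.legal t ht
    rw [rep_take_succ ht]
    exact mergeRep_idem ⟨ih, hl.1, hfix _ hl.2.1, hfix _ hl.2.2⟩ v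

lemma IsRequestSequence.legalRequest (hσ : IsRequestSequence ℓ σ) {t : ℕ} (ht : t < σ.length) :
    LegalRequest (rep (σ.take t)) σ[t] := by
  have hid := hσ.rep_idem ht.le
  have hfix : ∀ x, 0 < valuesAfter (σ.take t) x → rep (σ.take t) x = x := by
    intro x hx
    rw [hσ.valuesAfter_take, card_pos] at hx
    obtain ⟨u, hu⟩ := hx
    rw [mem_cls] at hu
    rw [← hu, hid]
  have hl := hσ.legal t ht
  exact ⟨hid, hl.1, hfix _ hl.2.1, hfix _ hl.2.2⟩

lemma sum_card_cls (ρ : Fin n → Fin n) (p : Fin n → Prop) [DecidablePred p] :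
    ∑ x ∈ univ.filter p, #(cls ρ x) = #(univ.filter (fun v => p (ρ v))) := by
  rw [card_eq_sum_card_fiberwise (f := ρ) (t := univ.filter p) (fun v hv => by simpa using hv)]
  refine sum_congr rfl fun x hx => ?_
  congr 1
  ext v
  simp only [mem_filter, mem_univ, true_and] at hx
  simp only [mem_cls, mem_filter, mem_univ, true_and]
  exact ⟨fun h => ⟨h ▸ hx, h⟩, fun h => h.2⟩

lemma IsRequestSequence.load_eq (hσ : IsRequestSequence ℓ σ) (t : ℕ) (a : Assignment n ℓ)
    (b : Fin ℓ) : load (valuesAfter (σ.take t)) a b =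
      #(univ.filter (fun v => a (rep (σ.take t) v) = b)) := by
  unfold load
  simp_rw [hσ.valuesAfter_take]
  exact sum_card_cls _ _

/-- Counting units block by block turns values into cardinalities. Composing with `rep` discards
what the assignments say about absorbed names. -/
lemma IsRequestSequence.moveCost_eq (hσ : IsRequestSequence ℓ σ) (t : ℕ) (a a' : Assignment n ℓ) :
    moveCost (valuesAfter (σ.take t)) a a' =
      hammingDist (a ∘ rep (σ.take t)) (a' ∘ rep (σ.take t)) := by
  unfold moveCost hammingDist
  simp_rw [hσ.valuesAfter_take]
  exact sum_card_cls _ _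

end Sequences

/-! ### Unit loads and balanced targets -/

lemma Respects.comp_eq {ρ : Fin n → Fin n} {a : Assignment n ℓ} (ha : Respects ρ a)
    (h : ∀ v, ρ (ρ v) = ρ v) : a ∘ ρ = a :=
  funext fun v => ha _ _ (h v)

/-- The number of units in bin `b`. -/
def unitLoad (a : Assignment n ℓ) (b : Fin ℓ) : ℕ := #(univ.filter (fun v => a v = b))

lemma unitLoad_le_add_hammingDist (a a' : Assignment n ℓ) (b : Fin ℓ) :
    unitLoad a b ≤ unitLoad a' b + hammingDist a a' := by
  unfold unitLoad hammingDist
  refine le_trans (card_le_card ?_) (card_union_le _ _)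
  intro v hv
  simp only [mem_union, mem_filter, mem_univ, true_and] at hv ⊢
  by_cases h : a v = a' v
  · left; rw [← h, hv]
  · right; exact h

/-- An assignment that is perfectly balanced and keeps all units of an integer together. -/
structure IsTarget (ρ : Fin n → Fin n) (f : Assignment n ℓ) : Prop where
  respects : Respects ρ f
  load : ∀ b, (unitLoad f b : ℝ) = (n : ℝ) / ℓ

/-- Blocks only grow, so a map constant on the final blocks is constant on all earlier ones. One
target thus serves the analysis at every time. -/
lemma IsTarget.take {σ : List (Request n)} {f : Assignment n ℓ} (hf : IsTarget (rep σ) f) (t : ℕ) :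
    IsTarget (rep (σ.take t)) f := by
  refine ⟨fun u v h => hf.respects u v ?_, hf.load⟩
  have := rep_append_eq_of_eq (σ.take t) (σ.drop t) h
  rwa [List.take_append_drop] at this

/-! ### The logarithmic potential and the joining of two summands -/

/-- The potential: the sum of the logarithms of the sizes of the integers containing units in `X`. -/
noncomputable def potential (X : Finset (Fin n)) (ρ : Fin n → Fin n) : ℝ :=
  ∑ v ∈ X, Real.logb 2 #(cls ρ (ρ v))

/-- Bernoulli's inequality for exponents in [0, 1]: (1 + 1)^x ≤ 1 + x. -/
lemma le_logb_one_add {x : ℝ} (h0 : 0 ≤ x) (h1 : x ≤ 1) : x ≤ Real.logb 2 (1 + x) := by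
  rw [Real.le_logb_iff_rpow_le (by norm_num) (by linarith)]
  have := rpow_one_add_le_one_add_mul_self (s := 1) (by norm_num) h0 h1
  norm_num at this
  exact this

lemma logb_add_ge_left {p q : ℝ} (hp : 0 < p) (hpq : p ≤ q) :
    Real.logb 2 p + 1 ≤ Real.logb 2 (p + q) := by
  have : Real.logb 2 p + 1 = Real.logb 2 (p * 2) := by
    rw [Real.logb_mul hp.ne' (by norm_num), Real.logb_self_eq_one (by norm_num)]
  rw [this]
  exact Real.logb_le_logb_of_le (by norm_num) (by linarith) (by linarith)

lemma logb_add_ge_right {p q : ℝ} (hp : 0 ≤ p) (hq : 0 < q) (hpq : p ≤ q) :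
    Real.logb 2 q + p / q ≤ Real.logb 2 (p + q) := by
  have h : p + q = q * (1 + p / q) := by field_simp; ring
  rw [h, Real.logb_mul hq.ne' (by positivity)]
  have := le_logb_one_add (x := p / q) (by positivity) ((div_le_one hq).2 hpq)
  linarith

/-- The summand of smaller value. -/
def smaller (ρ : Fin n → Fin n) (r : Request n) : Fin n :=
  if #(cls ρ r.1) ≤ #(cls ρ r.2) then r.1 else r.2

/-- The summand of larger value. -/
def larger (ρ : Fin n → Fin n) (r : Request n) : Fin n :=
  if #(cls ρ r.1) ≤ #(cls ρ r.2) then r.2 else r.1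

lemma card_smaller_le (ρ : Fin n → Fin n) (r : Request n) :
    #(cls ρ (smaller ρ r)) ≤ #(cls ρ (larger ρ r)) := by
  unfold smaller larger
  split_ifs <;> omega

section Step

variable {ρ : Fin n → Fin n} {r : Request n}

lemma LegalRequest.smaller_ne_larger (h : LegalRequest ρ r) : smaller ρ r ≠ larger ρ r := by
  have := h.ne
  unfold smaller larger
  split_ifs
  · exact this
  · exact this.symm

lemma LegalRequest.smaller_fix (h : LegalRequest ρ r) : ρ (smaller ρ r) = smaller ρ r := by
  unfold smaller
  split_ifs
  exacts [h.fst, h.snd]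

lemma LegalRequest.larger_fix (h : LegalRequest ρ r) : ρ (larger ρ r) = larger ρ r := by
  unfold larger
  split_ifs
  exacts [h.snd, h.fst]

lemma mergeRep_eq_fst_iff (v : Fin n) :
    mergeRep ρ r v = r.1 ↔ ρ v = smaller ρ r ∨ ρ v = larger ρ r := by
  unfold mergeRep smaller larger
  split_ifs <;> grind

lemma mergeRep_eq_of_ne {v : Fin n} (hs : ρ v ≠ smaller ρ r) (hl : ρ v ≠ larger ρ r) :
    mergeRep ρ r v = ρ v ∧ ρ v ≠ r.1 ∧ ρ v ≠ r.2 := by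
  unfold mergeRep
  unfold smaller at hs
  unfold larger at hl
  split_ifs at hs hl ⊢ <;> grind

lemma LegalRequest.card_cls_merge (h : LegalRequest ρ r) :
    #(cls (mergeRep ρ r) r.1) = #(cls ρ (smaller ρ r)) + #(cls ρ (larger ρ r)) := by
  rw [card_cls_mergeRep_fst h.ne]
  unfold smaller larger
  split_ifs <;> omega

/-- For sizes p ≤ q, a unit of the smaller summand at least doubles its block and gains at least 1,
while a unit of the larger one gains log(1 + p/q) ≥ p/q. Other units keep their blocks. -/
lemma LegalRequest.potential_step (h : LegalRequest ρ r) (X : Finset (Fin n)) :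
    potential X ρ + #(X.filter (fun v => ρ v = smaller ρ r)) +
      #(X.filter (fun v => ρ v = larger ρ r)) *
        ((#(cls ρ (smaller ρ r)) : ℝ) / #(cls ρ (larger ρ r))) ≤ potential X (mergeRep ρ r) := by
  set i := smaller ρ r
  set j := larger ρ r
  have hij : i ≠ j := h.smaller_ne_larger
  have hp : 0 < (#(cls ρ i) : ℝ) := by
    have := card_cls_pos ρ i
    rw [h.smaller_fix] at this
    exact_mod_cast this
  have hpq : (#(cls ρ i) : ℝ) ≤ #(cls ρ j) := by exact_mod_cast card_smaller_le ρ r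
  have e1 : (#(X.filter (fun v => ρ v = i)) : ℝ) = ∑ v ∈ X, if ρ v = i then (1 : ℝ) else 0 := by
    simp
  have e2 : #(X.filter (fun v => ρ v = j)) * ((#(cls ρ i) : ℝ) / #(cls ρ j)) =
      ∑ v ∈ X, if ρ v = j then ((#(cls ρ i) : ℝ) / #(cls ρ j)) else 0 := by
    rw [← sum_filter, sum_const, nsmul_eq_mul]
  rw [e1, e2]
  unfold potential
  rw [← sum_add_distrib, ← sum_add_distrib]
  refine sum_le_sum fun v _ => ?_
  by_cases hi : ρ v = i
  · have hm : mergeRep ρ r v = r.1 := (mergeRep_eq_fst_iff v).2 (Or.inl hi)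
    rw [hm, h.card_cls_merge, hi, if_pos rfl, if_neg hij]
    push_cast
    have := logb_add_ge_left hp hpq
    linarith
  · by_cases hj : ρ v = j
    · have hm : mergeRep ρ r v = r.1 := (mergeRep_eq_fst_iff v).2 (Or.inr hj)
      rw [hm, h.card_cls_merge, hj, if_pos rfl, if_neg hij.symm]
      push_cast
      have := logb_add_ge_right hp.le (hp.trans_le hpq) hpq
      linarith
    · obtain ⟨h1, h2, h3⟩ := mergeRep_eq_of_ne hi hj
      rw [h1, cls_mergeRep_of_ne h2 h3, if_neg hi, if_neg hj]
      simp

/-- Move the smaller summand to the bin of the larger one. -/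
def joinSmaller (ρ : Fin n → Fin n) (r : Request n) (a : Assignment n ℓ) : Assignment n ℓ :=
  fun v => if ρ v = smaller ρ r then a (larger ρ r) else a v

lemma LegalRequest.joinSmaller_of_eq_fst (h : LegalRequest ρ r) {a : Assignment n ℓ}
    (ha : Respects ρ a) {v : Fin n} (hv : mergeRep ρ r v = r.1) :
    joinSmaller ρ r a v = a (larger ρ r) := by
  unfold joinSmaller
  split_ifs with h1
  · rfl
  · refine ha _ _ ?_
    rw [h.larger_fix]
    exact ((mergeRep_eq_fst_iff v).1 hv).resolve_left h1

lemma LegalRequest.joinSmaller_of_ne_fst {a : Assignment n ℓ} {v : Fin n}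
    (hv : mergeRep ρ r v ≠ r.1) : joinSmaller ρ r a v = a v := by
  unfold joinSmaller
  rw [if_neg]
  intro h1
  exact hv ((mergeRep_eq_fst_iff v).2 (Or.inl h1))

lemma rep_eq_of_mergeRep_eq {u v : Fin n} (huv : mergeRep ρ r u = mergeRep ρ r v)
    (hu : mergeRep ρ r u ≠ r.1) : ρ u = ρ v := by
  have hv := huv ▸ hu
  unfold mergeRep at *
  split_ifs at * <;> simp_all

lemma LegalRequest.respects_joinSmaller (h : LegalRequest ρ r) {a : Assignment n ℓ}
    (ha : Respects ρ a) : Respects (mergeRep ρ r) (joinSmaller ρ r a) := by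
  intro u v huv
  by_cases hu : mergeRep ρ r u = r.1
  · rw [h.joinSmaller_of_eq_fst ha hu, h.joinSmaller_of_eq_fst ha (huv ▸ hu)]
  · rw [LegalRequest.joinSmaller_of_ne_fst hu, LegalRequest.joinSmaller_of_ne_fst (huv ▸ hu)]
    exact ha _ _ (rep_eq_of_mergeRep_eq huv hu)

lemma hammingDist_joinSmaller_le (a : Assignment n ℓ) :
    hammingDist a (joinSmaller ρ r a) ≤ #(cls ρ (smaller ρ r)) := by
  refine card_le_card fun v hv => ?_
  simp only [mem_filter, mem_univ, true_and] at hv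
  rw [mem_cls]
  by_contra hne
  exact hv (if_neg hne).symm

lemma LegalRequest.joinSmaller_eq_self (h : LegalRequest ρ r) {a : Assignment n ℓ}
    (ha : Respects ρ a) (he : a (smaller ρ r) = a (larger ρ r)) : joinSmaller ρ r a = a := by
  funext v
  unfold joinSmaller
  split_ifs with h1
  · rw [← he]
    refine ha _ _ ?_
    rw [h.smaller_fix, h1]
  · rfl

end Step

lemma potential_nonneg (X : Finset (Fin n)) (ρ : Fin n → Fin n) : 0 ≤ potential X ρ :=
  sum_nonneg fun v _ => Real.logb_nonneg (by norm_num) (by exact_mod_cast card_cls_pos ρ v)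

lemma potential_le (X : Finset (Fin n)) (ρ : Fin n → Fin n) :
    potential X ρ ≤ #X * Real.logb 2 n := by
  unfold potential
  rw [← nsmul_eq_mul, ← sum_const]
  refine sum_le_sum fun v _ => Real.logb_le_logb_of_le (by norm_num) ?_ ?_
  · exact_mod_cast card_cls_pos ρ v
  · have := card_le_univ (cls ρ (ρ v))
    rw [Fintype.card_fin] at this
    exact_mod_cast this

/-! ### Running a rule online -/

/-- Run a rule for changing the assignment along a request sequence. -/
def runRule (rule : (Fin n → Fin n) → Request n → Assignment n ℓ → Assignment n ℓ)
    (init : Assignment n ℓ) (σ : List (Request n)) : Assignment n ℓ :=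
  (σ.foldl (fun q r => (mergeRep q.1 r, rule q.1 r q.2)) ((id : Fin n → Fin n), init)).2

lemma foldl_fst (rule : (Fin n → Fin n) → Request n → Assignment n ℓ → Assignment n ℓ)
    (init : Assignment n ℓ) (σ : List (Request n)) :
    (σ.foldl (fun q r => (mergeRep q.1 r, rule q.1 r q.2)) ((id : Fin n → Fin n), init)).1 =
      rep σ := by
  induction σ using List.reverseRecOn with
  | nil => rfl
  | append_singleton σ r ih => rw [rep_append_singleton, ← ih]; simp [List.foldl_append]

lemma runRule_take_succ (rule : (Fin n → Fin n) → Request n → Assignment n ℓ → Assignment n ℓ)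
    (init : Assignment n ℓ) {σ : List (Request n)} {t : ℕ} (ht : t < σ.length) :
    runRule rule init (σ.take (t + 1)) =
      rule (rep (σ.take t)) σ[t] (runRule rule init (σ.take t)) := by
  rw [take_succ_eq ht, runRule, List.foldl_append, ← foldl_fst rule init]
  rfl

/-! ### The lazy rule -/

/-- More than three quarters of the integer named `x` are initially in bin `b`. -/
def IsPure (init : Assignment n ℓ) (ρ : Fin n → Fin n) (x : Fin n) (b : Fin ℓ) : Prop :=
  3 * #(cls ρ x) < 4 * #((cls ρ x).filter (fun v => init v = b))

open Classical in
/-- The lazy rule: move the smaller summand to the larger one, and then, if most of the sum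
comes from one bin, move the sum to that bin. -/
noncomputable def lazyRule (init : Assignment n ℓ) (ρ : Fin n → Fin n) (r : Request n)
    (a : Assignment n ℓ) : Assignment n ℓ :=
  if h : ∃ b, IsPure init (mergeRep ρ r) r.1 b then
    fun v => if mergeRep ρ r v = r.1 then h.choose else joinSmaller ρ r a v
  else joinSmaller ρ r a

lemma IsPure.unique {init : Assignment n ℓ} {ρ : Fin n → Fin n} {x : Fin n} {b c : Fin ℓ}
    (hb : IsPure init ρ x b) (hc : IsPure init ρ x c) : b = c := by
  by_contra hne
  have hd : Disjoint ((cls ρ x).filter (fun v => init v = b))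
      ((cls ρ x).filter (fun v => init v = c)) := by
    rw [disjoint_filter]
    intro v _ h1 h2
    exact hne (h1 ▸ h2)
  have := card_union_of_disjoint hd
  have h3 := card_le_card (union_subset (filter_subset (fun v => init v = b) (cls ρ x))
    (filter_subset (fun v => init v = c) (cls ρ x)))
  unfold IsPure at hb hc
  omega

/-- Every integer that comes mostly from one bin is in this bin. -/
def PureInPlace (init : Assignment n ℓ) (ρ : Fin n → Fin n) (a : Assignment n ℓ) : Prop :=
  ∀ v b, IsPure init ρ (ρ v) b → a v = b

/-- The units that a target assignment moves away from their initial bin. -/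
def displaced (init f : Assignment n ℓ) : Finset (Fin n) :=
  univ.filter (fun v => init v ≠ f v)

lemma card_displaced (init f : Assignment n ℓ) : #(displaced init f) = hammingDist init f := rfl

section Lazy

variable {ρ : Fin n → Fin n} {r : Request n} {init f a : Assignment n ℓ}

/-- The target puts the whole block into one bin, so each of its units that is not displaced
originates there. -/
lemma isPure_of_few_displaced (hf : Respects ρ f) {v : Fin n}
    (h : 4 * #((displaced init f).filter (fun u => ρ u = ρ v)) < #(cls ρ (ρ v))) :
    IsPure init ρ (ρ v) (f v) := by
  have h1 := card_filter_add_card_filter_not (s := cls ρ (ρ v)) (fun u => init u = f v)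
  have h2 : (cls ρ (ρ v)).filter (fun u => ¬ init u = f v) =
      (displaced init f).filter (fun u => ρ u = ρ v) := by
    ext u
    simp only [mem_filter, mem_cls, displaced, mem_univ, true_and]
    constructor
    · rintro ⟨h, h'⟩
      exact ⟨by rwa [hf u v h], h⟩
    · rintro ⟨h, h'⟩
      exact ⟨h', by rwa [← hf u v h']⟩
  rw [h2] at h1
  unfold IsPure
  omega

lemma hammingDist_fiberwise (ρ : Fin n → Fin n) (a a' : Assignment n ℓ) :
    hammingDist a a' = ∑ x, #((cls ρ x).filter (fun v => a v ≠ a' v)) := by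
  unfold hammingDist
  rw [card_eq_sum_card_fiberwise (f := ρ) (t := univ) (fun v _ => by simp)]
  refine sum_congr rfl fun x _ => ?_
  congr 1
  ext v
  simp [mem_cls, and_comm]

/-- Compare block by block. A block with under a quarter of its units displaced is pure, so the
current assignment agrees with the target on it; any other block has at most four times as many
units as displaced units. -/
lemma hammingDist_init_le (hf : Respects ρ f) (hp : PureInPlace init ρ a) :
    hammingDist a init ≤ 4 * hammingDist init f := by
  rw [hammingDist_fiberwise ρ a, hammingDist_fiberwise ρ init f, mul_sum]
  refine sum_le_sum fun x _ => ?_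
  have hD : (cls ρ x).filter (fun v => init v ≠ f v) =
      (displaced init f).filter (fun u => ρ u = x) := by
    ext u
    simp [mem_cls, displaced, and_comm]
  by_cases hx : 4 * #((cls ρ x).filter (fun v => init v ≠ f v)) < #(cls ρ x)
  · have : (cls ρ x).filter (fun v => a v ≠ init v) ⊆
        (cls ρ x).filter (fun v => init v ≠ f v) := by
      intro v hv
      rw [mem_filter] at hv ⊢
      refine ⟨hv.1, fun h => hv.2 ?_⟩
      obtain rfl := mem_cls.1 hv.1
      rw [h]
      refine hp v _ (isPure_of_few_displaced hf ?_)
      rwa [← hD]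
    have := card_le_card this
    omega
  · have := card_filter_le (cls ρ x) (fun v => a v ≠ init v)
    omega

lemma lazyRule_of_ne_fst {v : Fin n} (hv : mergeRep ρ r v ≠ r.1) :
    lazyRule init ρ r a v = a v := by
  unfold lazyRule
  split_ifs with h
  · simp only [hv, if_false]
    exact LegalRequest.joinSmaller_of_ne_fst hv
  · rw [LegalRequest.joinSmaller_of_ne_fst hv]

lemma LegalRequest.respects_lazyRule (h : LegalRequest ρ r) (ha : Respects ρ a) :
    Respects (mergeRep ρ r) (lazyRule init ρ r a) := by
  have hj := h.respects_joinSmaller ha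
  unfold lazyRule
  split_ifs with hb
  · intro u v huv
    simp only [huv]
    split_ifs
    · rfl
    · exact hj u v huv
  · exact hj

lemma pureInPlace_lazyRule (hp : PureInPlace init ρ a) :
    PureInPlace init (mergeRep ρ r) (lazyRule init ρ r a) := by
  intro v b hb
  by_cases hv : mergeRep ρ r v = r.1
  · rw [hv] at hb
    have hex : ∃ b, IsPure init (mergeRep ρ r) r.1 b := ⟨b, hb⟩
    unfold lazyRule
    rw [dif_pos hex]
    simp only [hv, if_true]
    exact hex.choose_spec.unique hb
  · rw [lazyRule_of_ne_fst hv]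
    refine hp v b ?_
    have hs : ρ v ≠ smaller ρ r := fun h' => hv ((mergeRep_eq_fst_iff v).2 (Or.inl h'))
    have hl : ρ v ≠ larger ρ r := fun h' => hv ((mergeRep_eq_fst_iff v).2 (Or.inr h'))
    obtain ⟨h1, h2, h3⟩ := mergeRep_eq_of_ne hs hl
    unfold IsPure at hb ⊢
    rwa [h1, cls_mergeRep_of_ne h2 h3] at hb

/-- Joining the two summands costs at most four times the increase of the potential. -/
lemma LegalRequest.hammingDist_joinSmaller_lazy (h : LegalRequest ρ r) (ha : Respects ρ a)
    (hp : PureInPlace init ρ a) (hf : Respects (mergeRep ρ r) f) :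
    (hammingDist a (joinSmaller ρ r a) : ℝ) ≤
      4 * (potential (displaced init f) (mergeRep ρ r) - potential (displaced init f) ρ) := by
  have hstep := h.potential_step (displaced init f)
  have hfρ : Respects ρ f := fun u v huv => hf u v (mergeRep_respects huv)
  have hfe : f (smaller ρ r) = f (larger ρ r) := by
    refine hf _ _ ?_
    rw [(mergeRep_eq_fst_iff _).2 (Or.inl h.smaller_fix),
      (mergeRep_eq_fst_iff _).2 (Or.inr h.larger_fix)]
  have hi := h.smaller_fix
  have hj := h.larger_fix
  have hd := hammingDist_joinSmaller_le (ρ := ρ) (r := r) a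
  have hq := card_cls_pos ρ (larger ρ r)
  rw [hj] at hq
  have he := h.joinSmaller_eq_self ha
  set i := smaller ρ r
  set j := larger ρ r
  set x := #((displaced init f).filter (fun v => ρ v = i))
  set y := #((displaced init f).filter (fun v => ρ v = j))
  set p := #(cls ρ i)
  set q := #(cls ρ j)
  have hq' : (0 : ℝ) < q := Nat.cast_pos.2 hq
  have hd' : (hammingDist a (joinSmaller ρ r a) : ℝ) ≤ p := Nat.cast_le.2 hd
  have hy0 : 0 ≤ (y : ℝ) * ((p : ℝ) / q) := by positivity
  -- If a quarter of the smaller summand is displaced, its gain of 1 per unit pays for the p units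
  -- moved.
  by_cases hx : p ≤ 4 * x
  · have : (p : ℝ) ≤ 4 * x := by exact_mod_cast hx
    linarith
  -- If a quarter of the larger summand is displaced, at least q/4 units gain p/q each, again p/4 in
  -- total.
  · by_cases hy : q ≤ 4 * y
    · have h4 : (q : ℝ) ≤ 4 * y := by exact_mod_cast hy
      have : (p : ℝ) ≤ 4 * (y * (p / q)) := by
        have e : (p : ℝ) = q * (p / q) := by field_simp
        calc (p : ℝ) = q * (p / q) := e
          _ ≤ (4 * y) * (p / q) := mul_le_mul_of_nonneg_right h4 (div_nonneg (Nat.cast_nonneg _) hq'.le)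
          _ = _ := by ring
      have : (0 : ℝ) ≤ x := by positivity
      linarith
    -- Otherwise both summands are pure and sit in the bins of the target, which puts them together:
    -- nothing is moved.
    · have h1 : a i = f i := by
        refine hp i _ (isPure_of_few_displaced hfρ ?_)
        rw [hi]
        omega
      have h2 : a j = f j := by
        refine hp j _ (isPure_of_few_displaced hfρ ?_)
        rw [hj]
        omega
      rw [he (by rw [h1, h2, hfe]), hammingDist_self]
      have : (0 : ℝ) ≤ x := by positivity
      push_cast
      linarith

/-- Moving an integer to the bin most of it comes from is paid by the decrease of the distance
from the initial assignment. -/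
lemma LegalRequest.hammingDist_joinSmaller_lazyRule (h : LegalRequest ρ r) (ha : Respects ρ a) :
    hammingDist (joinSmaller ρ r a) (lazyRule init ρ r a) +
      2 * hammingDist (lazyRule init ρ r a) init ≤ 2 * hammingDist (joinSmaller ρ r a) init := by
  by_cases hb : ∃ b, IsPure init (mergeRep ρ r) r.1 b
  swap
  · have : lazyRule init ρ r a = joinSmaller ρ r a := by rw [lazyRule, dif_neg hb]
    rw [this, hammingDist_self]
    omega
  have hpure := hb.choose_spec
  set b := hb.choose with hbdef
  have hin : ∀ v, mergeRep ρ r v = r.1 → lazyRule init ρ r a v = b := by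
    intro v hv
    unfold lazyRule
    rw [dif_pos hb]
    simp only [hv, if_true]
    rfl
  have hout : ∀ v, mergeRep ρ r v ≠ r.1 → lazyRule init ρ r a v = joinSmaller ρ r a v := by
    intro v hv
    rw [lazyRule_of_ne_fst hv, LegalRequest.joinSmaller_of_ne_fst hv]
  have hjn : ∀ v, mergeRep ρ r v = r.1 → joinSmaller ρ r a v = a (larger ρ r) :=
    fun v hv => h.joinSmaller_of_eq_fst ha hv
  by_cases hc : a (larger ρ r) = b
  · have : lazyRule init ρ r a = joinSmaller ρ r a := by
      funext v
      by_cases hv : mergeRep ρ r v = r.1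
      · rw [hin v hv, hjn v hv, hc]
      · exact hout v hv
    rw [this, hammingDist_self]
    omega
  · rw [hammingDist_fiberwise (mergeRep ρ r) (joinSmaller ρ r a),
      hammingDist_fiberwise (mergeRep ρ r) (lazyRule init ρ r a),
      hammingDist_fiberwise (mergeRep ρ r) (joinSmaller ρ r a), mul_sum, mul_sum,
      ← sum_add_distrib]
    refine sum_le_sum fun x _ => ?_
    by_cases hx : x = r.1
    · subst hx
      -- In a sum of size s, more than 3s/4 units are away from home before the move and fewer than
      -- s/4 after it. Twice the decrease therefore exceeds the cost, which is at most s.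
      have h1 := card_filter_le (cls (mergeRep ρ r) r.1)
        (fun v => joinSmaller ρ r a v ≠ lazyRule init ρ r a v)
      have h2 : #((cls (mergeRep ρ r) r.1).filter (fun v => lazyRule init ρ r a v ≠ init v)) ≤
          #((cls (mergeRep ρ r) r.1).filter (fun v => ¬ init v = b)) := by
        refine card_le_card fun v hv => ?_
        rw [mem_filter, mem_cls] at hv ⊢
        rw [hin v hv.1] at hv
        exact ⟨hv.1, fun e => hv.2 e.symm⟩
      have h3 : #((cls (mergeRep ρ r) r.1).filter (fun v => init v = b)) ≤
          #((cls (mergeRep ρ r) r.1).filter (fun v => joinSmaller ρ r a v ≠ init v)) := by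
        refine card_le_card fun v hv => ?_
        rw [mem_filter, mem_cls] at hv ⊢
        rw [hjn v hv.1, hv.2]
        exact ⟨hv.1, hc⟩
      have h4 := card_filter_add_card_filter_not (s := cls (mergeRep ρ r) r.1)
        (fun v => init v = b)
      unfold IsPure at hpure
      omega
    · have e : ∀ v ∈ cls (mergeRep ρ r) x, lazyRule init ρ r a v = joinSmaller ρ r a v := by
        intro v hv
        refine hout v ?_
        rw [mem_cls.1 hv]
        exact hx
      have h1 : (cls (mergeRep ρ r) x).filter
          (fun v => joinSmaller ρ r a v ≠ lazyRule init ρ r a v) = ∅ := by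
        rw [filter_eq_empty_iff]
        intro v hv
        rw [e v hv]
        simp
      have h2 : (cls (mergeRep ρ r) x).filter (fun v => lazyRule init ρ r a v ≠ init v) =
          (cls (mergeRep ρ r) x).filter (fun v => joinSmaller ρ r a v ≠ init v) := by
        refine filter_congr fun v hv => ?_
        rw [e v hv]
      rw [h1, h2, card_empty]
      omega

/-- A join of cost J raises twice the distance from the initial assignment by at most 2J, and the
return move is paid by that term. The amortized cost is thus at most 3J, with J at most four times
the gain in potential. -/
lemma LegalRequest.lazyRule_amortized (h : LegalRequest ρ r) (ha : Respects ρ a)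
    (hp : PureInPlace init ρ a) (hf : Respects (mergeRep ρ r) f) :
    (hammingDist a (lazyRule init ρ r a) : ℝ) + 2 * hammingDist (lazyRule init ρ r a) init ≤
      2 * hammingDist a init +
        12 * (potential (displaced init f) (mergeRep ρ r) - potential (displaced init f) ρ) := by
  have h1 := h.hammingDist_joinSmaller_lazy ha hp hf
  have h2 : (hammingDist (joinSmaller ρ r a) (lazyRule init ρ r a) : ℝ) +
      2 * hammingDist (lazyRule init ρ r a) init ≤ 2 * hammingDist (joinSmaller ρ r a) init := by
    exact_mod_cast h.hammingDist_joinSmaller_lazyRule (init := init) ha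
  have h3 : (hammingDist a (lazyRule init ρ r a) : ℝ) ≤ hammingDist a (joinSmaller ρ r a) +
      hammingDist (joinSmaller ρ r a) (lazyRule init ρ r a) := by
    exact_mod_cast hammingDist_triangle _ _ _
  have h4 : (hammingDist (joinSmaller ρ r a) init : ℝ) ≤
      hammingDist a (joinSmaller ρ r a) + hammingDist a init := by
    rw [hammingDist_comm a (joinSmaller ρ r a)]
    exact_mod_cast hammingDist_triangle _ _ _
  linarith

end Lazy

/-- The assignments produced by the lazy rule. -/
noncomputable def lazyRun (init : Assignment n ℓ) (σ : List (Request n)) : Assignment n ℓ :=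
  runRule (lazyRule init) init σ

section LazyRun

variable {σ : List (Request n)} {init f : Assignment n ℓ}

lemma respects_id (a : Assignment n ℓ) : Respects (rep ([] : List (Request n))) a := by
  intro u v huv
  have : u = v := huv
  rw [this]

lemma respects_lazyRun (hσ : IsRequestSequence ℓ σ) {t : ℕ} (ht : t ≤ σ.length) :
    Respects (rep (σ.take t)) (lazyRun init (σ.take t)) := by
  induction t with
  | zero => simpa using respects_id _
  | succ t ih =>
    rw [lazyRun, runRule_take_succ _ _ ht, rep_take_succ ht]
    exact (hσ.legalRequest ht).respects_lazyRule (ih (by omega))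

lemma pureInPlace_lazyRun {t : ℕ} (ht : t ≤ σ.length) :
    PureInPlace init (rep (σ.take t)) (lazyRun init (σ.take t)) := by
  induction t with
  | zero =>
    intro v b hb
    simp only [List.take_zero] at hb ⊢
    have hb : IsPure init id v b := hb
    have hpos : 0 < #((cls id v).filter (fun u => init u = b)) := by
      unfold IsPure at hb
      omega
    obtain ⟨u, hu⟩ := card_pos.1 hpos
    rw [mem_filter, mem_cls] at hu
    obtain ⟨rfl, hu⟩ := hu
    exact hu
  | succ t ih =>
    rw [lazyRun, runRule_take_succ _ _ ht, rep_take_succ ht]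
    exact pureInPlace_lazyRule (ih (by omega))

lemma lazyRun_cost_add_le (hσ : IsRequestSequence ℓ σ) (hf : IsTarget (rep σ) f) {t : ℕ}
    (ht : t ≤ σ.length) :
    (∑ k ∈ range t, (hammingDist (lazyRun init (σ.take k)) (lazyRun init (σ.take (k + 1))) : ℝ)) +
      2 * hammingDist (lazyRun init (σ.take t)) init ≤
        12 * potential (displaced init f) (rep (σ.take t)) := by
  induction t with
  | zero =>
    have : lazyRun init ([] : List (Request n)) = init := rfl
    have h0 := potential_nonneg (displaced init f) (rep ([] : List (Request n)))
    simp [this, h0]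
  | succ t ih =>
    have ih := ih (by omega)
    rw [sum_range_succ]
    have hft := (hf.take (t + 1)).respects
    rw [rep_take_succ ht] at hft
    have := (hσ.legalRequest ht).lazyRule_amortized (respects_lazyRun hσ (by omega))
      (pureInPlace_lazyRun (init := init) (by omega)) hft
    rw [rep_take_succ ht]
    have e : lazyRun init (σ.take (t + 1)) =
      lazyRule init (rep (σ.take t)) σ[t] (lazyRun init (σ.take t)) := runRule_take_succ _ _ ht
    rw [e]
    linarith

lemma lazyRun_cost_le (hσ : IsRequestSequence ℓ σ) (hf : IsTarget (rep σ) f) :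
    (∑ k ∈ range σ.length,
      (hammingDist (lazyRun init (σ.take k)) (lazyRun init (σ.take (k + 1))) : ℝ)) ≤
        12 * (hammingDist init f * Real.logb 2 n) := by
  have h1 := lazyRun_cost_add_le (init := init) hσ hf le_rfl
  have h2 := potential_le (displaced init f) (rep (σ.take σ.length))
  rw [card_displaced] at h2
  have : (0 : ℝ) ≤ hammingDist (lazyRun init (σ.take σ.length)) init := by positivity
  linarith

/-- The factor 5 is 4 for the distance to the initial assignment plus 1 from there to the target. -/
lemma unitLoad_lazyRun_le (hf : IsTarget (rep σ) f) {t : ℕ}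
    (ht : t ≤ σ.length) (b : Fin ℓ) :
    (unitLoad (lazyRun init (σ.take t)) b : ℝ) ≤ (n : ℝ) / ℓ + 5 * hammingDist init f := by
  rw [← hf.load b]
  have h1 := unitLoad_le_add_hammingDist (lazyRun init (σ.take t)) f b
  have h2 := hammingDist_triangle (lazyRun init (σ.take t)) init f
  have h3 := hammingDist_init_le (hf.take t).respects (pureInPlace_lazyRun (init := init) ht)
  have : unitLoad (lazyRun init (σ.take t)) b ≤ unitLoad f b + 5 * hammingDist init f := by omega
  exact_mod_cast this

end LazyRun

/-! ### The rebalancing rule -/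

/-- All bins respect the capacity `(1 + ε) n / ℓ`, counting units. -/
def UnitCapacity (ε : ℝ) (a : Assignment n ℓ) : Prop :=
  ∀ b, (unitLoad a b : ℝ) ≤ (1 + ε) * n / ℓ

/-- `f` is a target assignment as close as possible to `init`. -/
def IsClosest (init : Assignment n ℓ) (ρ : Fin n → Fin n) (f : Assignment n ℓ) : Prop :=
  IsTarget ρ f ∧ ∀ g : Assignment n ℓ, IsTarget ρ g → hammingDist init f ≤ hammingDist init g

lemma exists_isClosest (init : Assignment n ℓ) {ρ : Fin n → Fin n} {g : Assignment n ℓ}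
    (hg : IsTarget ρ g) : ∃ f, IsClosest init ρ f := by
  obtain ⟨f, hf, hmin⟩ := exists_minimalFor_of_wellFoundedLT (fun f => IsTarget ρ f)
    (fun f : Assignment n ℓ => hammingDist init f) ⟨g, hg⟩
  refine ⟨f, hf, fun g hg => ?_⟩
  rcases le_total (hammingDist init f) (hammingDist init g) with h | h
  · exact h
  · exact hmin hg h

open Classical in
/-- A target assignment as close as possible to `init`, if there is a target assignment. -/
noncomputable def closest (init : Assignment n ℓ) (ρ : Fin n → Fin n) : Assignment n ℓ :=
  if h : ∃ f, IsClosest init ρ f then h.choose else init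

lemma isClosest_closest (init : Assignment n ℓ) {ρ : Fin n → Fin n} {g : Assignment n ℓ}
    (hg : IsTarget ρ g) : IsClosest init ρ (closest init ρ) := by
  have h := exists_isClosest init hg
  unfold closest
  rw [dif_pos h]
  exact h.choose_spec

open Classical in
/-- The rebalancing rule: move the smaller summand to the larger one; if this violates a
capacity, pass to the balanced assignment closest to the initial one. -/
noncomputable def rebalanceRule (ε : ℝ) (init : Assignment n ℓ) (ρ : Fin n → Fin n)
    (r : Request n) (a : Assignment n ℓ) : Assignment n ℓ :=
  if UnitCapacity ε (joinSmaller ρ r a) then joinSmaller ρ r a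
  else closest init (mergeRep ρ r)

/-- The assignments produced by the rebalancing rule. -/
noncomputable def rebalanceRun (ε : ℝ) (init : Assignment n ℓ) (σ : List (Request n)) :
    Assignment n ℓ :=
  runRule (rebalanceRule ε init) init σ

lemma IsTarget.unitCapacity {ρ : Fin n → Fin n} {f : Assignment n ℓ} (hf : IsTarget ρ f) {ε : ℝ}
    (hε : 0 ≤ ε) : UnitCapacity ε f := by
  intro b
  rw [hf.load b]
  gcongr
  nlinarith [Nat.cast_nonneg (α := ℝ) n]

section Rebalance

variable {σ : List (Request n)} {init f : Assignment n ℓ} {ε : ℝ}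

lemma rebalanceRun_take_succ {t : ℕ} (ht : t < σ.length) :
    rebalanceRun ε init (σ.take (t + 1)) =
      rebalanceRule ε init (rep (σ.take t)) σ[t] (rebalanceRun ε init (σ.take t)) :=
  runRule_take_succ _ _ ht

lemma respects_rebalanceRun (hσ : IsRequestSequence ℓ σ) (hf : IsTarget (rep σ) f) {t : ℕ}
    (ht : t ≤ σ.length) : Respects (rep (σ.take t)) (rebalanceRun ε init (σ.take t)) := by
  induction t with
  | zero => simpa using respects_id _
  | succ t ih =>
    have hft := hf.take (t + 1)
    rw [rep_take_succ ht] at hft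
    rw [rebalanceRun_take_succ ht, rep_take_succ ht]
    unfold rebalanceRule
    split_ifs
    · exact (hσ.legalRequest ht).respects_joinSmaller (ih (by omega))
    · exact (isClosest_closest init hft).1.respects

lemma unitCapacity_rebalanceRun (hf : IsTarget (rep σ) f) (hε : 0 ≤ ε)
    (hinit : UnitCapacity ε init) {t : ℕ} (ht : t ≤ σ.length) :
    UnitCapacity ε (rebalanceRun ε init (σ.take t)) := by
  cases t with
  | zero => exact hinit
  | succ t =>
    have hft := hf.take (t + 1)
    rw [rep_take_succ ht] at hft
    rw [rebalanceRun_take_succ ht]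
    unfold rebalanceRule
    split_ifs with h
    · exact h
    · exact (isClosest_closest init hft).1.unitCapacity hε

/-- `R` counts the rebalancing steps. -/
lemma exists_rebalanceRun_bound (hσ : IsRequestSequence ℓ σ) (hf : IsTarget (rep σ) f)
    (hε : 0 ≤ ε) (hinit : UnitCapacity ε init) {t : ℕ} (ht : t ≤ σ.length) :
    ∃ R : ℕ,
      (∑ k ∈ range t, (hammingDist (rebalanceRun ε init (σ.take k))
        (rebalanceRun ε init (σ.take (k + 1))) : ℝ)) +
          hammingDist (rebalanceRun ε init (σ.take t)) init ≤
            2 * hammingDist init f * R + 2 * potential univ (rep (σ.take t)) ∧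
      R * (ε * n / ℓ) ≤ potential univ (rep (σ.take t)) + ε * n / ℓ ∧
      ∀ b, R * (ε * n / ℓ) + (unitLoad (rebalanceRun ε init (σ.take t)) b - (n : ℝ) / ℓ) ≤
        potential univ (rep (σ.take t)) + ε * n / ℓ := by
  induction t with
  | zero =>
    have h0 := potential_nonneg univ (rep ([] : List (Request n)))
    have e : rebalanceRun ε init ([] : List (Request n)) = init := rfl
    have hs : 0 ≤ ε * n / ℓ := by positivity
    refine ⟨0, ?_, ?_, fun b => ?_⟩
    · simpa [e] using h0
    · simp only [List.take_zero, Nat.cast_zero, zero_mul]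
      linarith
    · have := hinit b
      simp only [List.take_zero, Nat.cast_zero, zero_mul, e]
      have e2 : (1 + ε) * n / ℓ = n / ℓ + ε * n / ℓ := by ring
      linarith
  | succ t ih =>
    obtain ⟨R, h1, h2, h3⟩ := ih (by omega)
    have hft := hf.take (t + 1)
    have hl := hσ.legalRequest ht
    have hstep := hl.potential_step univ
    rw [sum_range_succ, rebalanceRun_take_succ ht, rep_take_succ ht]
    rw [rep_take_succ ht] at hft
    set ρ := rep (σ.take t)
    set a := rebalanceRun ε init (σ.take t)
    have hp : (hammingDist a (joinSmaller ρ σ[t] a) : ℝ) ≤ #(cls ρ (smaller ρ σ[t])) := by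
      exact_mod_cast hammingDist_joinSmaller_le a
    have hfil : univ.filter (fun v => ρ v = smaller ρ σ[t]) = cls ρ (smaller ρ σ[t]) := rfl
    rw [hfil] at hstep
    have hnn : (0 : ℝ) ≤ #(univ.filter (fun v => ρ v = larger ρ σ[t])) *
        ((#(cls ρ (smaller ρ σ[t])) : ℝ) / #(cls ρ (larger ρ σ[t]))) := by positivity
    have hmove : (hammingDist a (joinSmaller ρ σ[t] a) : ℝ) ≤
        potential univ (mergeRep ρ σ[t]) - potential univ ρ := by linarith
    have hpos : (0 : ℝ) ≤ hammingDist a (joinSmaller ρ σ[t] a) := by positivity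
    have hload : ∀ b, (unitLoad (joinSmaller ρ σ[t] a) b : ℝ) ≤
        unitLoad a b + hammingDist a (joinSmaller ρ σ[t] a) := by
      intro b
      rw [hammingDist_comm]
      exact_mod_cast unitLoad_le_add_hammingDist _ _ b
    unfold rebalanceRule
    split_ifs with hc
    -- A join raises the cost, the distance to the initial assignment and each load by at most the
    -- gain in potential; the first two together explain the factor 2.
    · refine ⟨R, ?_, by linarith, fun b => ?_⟩
      · have : (hammingDist (joinSmaller ρ σ[t] a) init : ℝ) ≤
            hammingDist a (joinSmaller ρ σ[t] a) + hammingDist a init := by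
          rw [hammingDist_comm a (joinSmaller ρ σ[t] a)]
          exact_mod_cast hammingDist_triangle _ _ _
        linarith
      · linarith [h3 b, hload b]
    · obtain ⟨hct, hcm⟩ := isClosest_closest init hft
      have hc1 : (hammingDist init (closest init (mergeRep ρ σ[t])) : ℝ) ≤
          hammingDist init f := by exact_mod_cast hcm f hft
      -- The violated bin exceeds n/ℓ by more than εn/ℓ, so the load invariant at that bin pays for
      -- one more rebalancing, after which all excesses are 0.
      have hbound : (R + 1) * (ε * n / ℓ) ≤ potential univ (mergeRep ρ σ[t]) + ε * n / ℓ := by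
        unfold UnitCapacity at hc
        push Not at hc
        obtain ⟨b, hb⟩ := hc
        have e2 : (1 + ε) * n / ℓ = n / ℓ + ε * n / ℓ := by ring
        linarith [h3 b, hload b]
      refine ⟨R + 1, ?_, by push_cast; exact hbound, fun b => ?_⟩
      -- Going back through the initial assignment uses up the stored distance, and the way to the
      -- closest target costs at most Δ. The new stored distance is at most Δ as well.
      · have h4 : (hammingDist a (closest init (mergeRep ρ σ[t])) : ℝ) ≤
            hammingDist a init + hammingDist init (closest init (mergeRep ρ σ[t])) := by
          exact_mod_cast hammingDist_triangle _ _ _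
        rw [hammingDist_comm (closest init (mergeRep ρ σ[t])) init]
        push_cast
        linarith
      · rw [hct.load b]
        push_cast
        linarith

end Rebalance

open Classical in
/-- Follow the lazy rule as long as it respects the capacities, then follow the rebalancing
rule. -/
noncomputable def combined (n ℓ : ℕ) (ε : ℝ) : OnlineAlgorithm n ℓ := fun init τ =>
  if ∀ k ≤ τ.length, UnitCapacity ε (lazyRun init (τ.take k)) then lazyRun init τ
  else rebalanceRun ε init τ

/-! ### Schedules in terms of units, and the lower bound on the offline cost -/

section Schedule

variable {σ : List (Request n)} {init f : Assignment n ℓ} {ε : ℝ} {a : ℕ → Assignment n ℓ}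

lemma IsRequestSequence.withinCapacity_iff (hσ : IsRequestSequence ℓ σ) {t : ℕ}
    (ht : t ≤ σ.length) {a : Assignment n ℓ} (ha : Respects (rep (σ.take t)) a) :
    WithinCapacity ε (valuesAfter (σ.take t)) a ↔ UnitCapacity ε a := by
  unfold WithinCapacity UnitCapacity unitLoad
  simp_rw [hσ.load_eq]
  have h : ∀ v, a (rep (σ.take t) v) = a v := congrFun (ha.comp_eq (hσ.rep_idem ht))
  simp_rw [h]

lemma isSchedule_of_respects (hσ : IsRequestSequence ℓ σ) (h0 : a 0 = init)
    (hr : ∀ t ≤ σ.length, Respects (rep (σ.take t)) (a t))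
    (hc : ∀ t ≤ σ.length, UnitCapacity ε (a t)) : IsSchedule ε init σ a := by
  refine ⟨h0, fun t ht => ?_, fun t ht => (hσ.withinCapacity_iff ht (hr t ht)).2 (hc t ht)⟩
  refine hr (t + 1) ht _ _ ?_
  have hl := hσ.legalRequest ht
  rw [rep_take_succ ht]
  simp [mergeRep, hl.fst, hl.snd]

lemma scheduleCost_of_respects (hσ : IsRequestSequence ℓ σ)
    (hr : ∀ t ≤ σ.length, Respects (rep (σ.take t)) (a t)) :
    scheduleCost σ a = ∑ t ∈ range σ.length, hammingDist (a t) (a (t + 1)) := by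
  refine sum_congr rfl fun t ht => ?_
  have ht := mem_range.1 ht
  have hid := hσ.rep_idem ht.le
  rw [hσ.moveCost_eq, (hr t ht.le).comp_eq hid]
  have h2 : Respects (rep (σ.take t)) (a (t + 1)) := fun u v huv => by
    refine hr (t + 1) ht u v ?_
    rw [rep_take_succ ht]
    exact mergeRep_respects huv
  rw [h2.comp_eq hid]

lemma IsSchedule.hammingDist_le (hσ : IsRequestSequence ℓ σ) (ha : IsSchedule ε init σ a) {t : ℕ}
    (ht : t ≤ σ.length) : hammingDist init (a t ∘ rep (σ.take t)) ≤
      ∑ k ∈ range t, moveCost (valuesAfter (σ.take k)) (a k) (a (k + 1)) := by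
  induction t with
  | zero =>
    have : a 0 ∘ rep (σ.take 0) = init := by rw [ha.start]; rfl
    rw [this, hammingDist_self]
    exact Nat.zero_le _
  | succ t ih =>
    rw [sum_range_succ, hσ.moveCost_eq]
    -- The addition itself displaces no unit, since the two summands already share a bin.
    have e : a (t + 1) ∘ rep (σ.take (t + 1)) = a (t + 1) ∘ rep (σ.take t) := by
      funext v
      rw [rep_take_succ ht]
      simp only [Function.comp_apply, mergeRep]
      split_ifs with h
      · rw [h]
        exact ha.together t ht
      · rfl
    rw [e]
    exact (hammingDist_triangle _ (a t ∘ rep (σ.take t)) _).trans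
      (Nat.add_le_add_right (ih (by omega)) _)

lemma sum_unitLoad (a : Assignment n ℓ) : ∑ b, unitLoad a b = n := by
  have := card_eq_sum_card_fiberwise (f := a) (s := univ) (t := univ) (fun v _ => by simp)
  rw [card_univ, Fintype.card_fin] at this
  exact this.symm

/-- At the end every integer is n/ℓ and capacities are below 2n/ℓ, so each bin holds at most one
integer. Loads of at most n/ℓ that sum to n must all equal n/ℓ. -/
lemma IsSchedule.exists_isTarget (hσ : IsRequestSequence ℓ σ) (hn : 0 < n) (hℓ : 0 < ℓ)
    (hε : ε < 1) (ha : IsSchedule ε init σ a) :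
    ∃ f, IsTarget (rep σ) f ∧ hammingDist init f ≤ scheduleCost σ a := by
  have hle := ha.hammingDist_le hσ le_rfl
  have hcap := ha.capacity _ le_rfl
  have hload := hσ.load_eq σ.length (a σ.length)
  rw [List.take_length] at hle hcap hload
  refine ⟨a σ.length ∘ rep σ, ⟨fun u v huv => by simp [huv], ?_⟩, hle⟩
  have hload' : ∀ b, load (valuesAfter σ) (a σ.length) b =
      unitLoad (a σ.length ∘ rep σ) b := hload
  have hs : (0 : ℝ) < n / ℓ := by positivity
  have hbound : ∀ b, (unitLoad (a σ.length ∘ rep σ) b : ℝ) ≤ n / ℓ := by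
    intro b
    have h1 := hcap b
    rw [← hload']
    have h2 : (load (valuesAfter σ) (a σ.length) b : ℝ) =
        #((univ.filter (fun i => a σ.length i = b)).filter
          (fun i => 0 < valuesAfter σ i)) * ((n : ℝ) / ℓ) := by
      unfold load
      rw [← nsmul_eq_mul, ← sum_const, sum_filter (p := fun i => 0 < valuesAfter σ i)]
      push_cast
      refine sum_congr rfl fun i _ => ?_
      split_ifs with hi
      · exact hσ.final_value i hi
      · have : valuesAfter σ i = 0 := by omega
        simp [this]
    rw [h2] at h1 ⊢
    set k := #((univ.filter (fun i => a σ.length i = b)).filter (fun i => 0 < valuesAfter σ i))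
    have h3 : (k : ℝ) < 2 := by
      by_contra hk
      push Not at hk
      have e : (1 + ε) * n / ℓ = (1 + ε) * (n / ℓ) := by ring
      nlinarith
    have h4 : (k : ℝ) ≤ 1 := by
      have : k < 2 := by exact_mod_cast h3
      have : k ≤ 1 := by omega
      exact_mod_cast this
    nlinarith
  have hsum : ∑ b, (unitLoad (a σ.length ∘ rep σ) b : ℝ) = ∑ _b : Fin ℓ, (n : ℝ) / ℓ := by
    rw [sum_const, card_univ, Fintype.card_fin, nsmul_eq_mul, mul_div_cancel₀]
    · exact_mod_cast sum_unitLoad _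
    · positivity
  intro b
  exact (sum_eq_sum_iff_of_le (fun b _ => hbound b)).1 hsum b (mem_univ b)

lemma IsRequestSequence.exists_isTarget (hσ : IsRequestSequence ℓ σ) :
    ∃ f : Assignment n ℓ, IsTarget (rep σ) f := by
  obtain ⟨a, ha⟩ := hσ.balanced σ.length le_rfl
  have hload := hσ.load_eq σ.length a
  rw [List.take_length] at ha hload
  refine ⟨a ∘ rep σ, fun u v huv => by simp [huv], fun b => ?_⟩
  rw [← ha b, hload]
  rfl

end Schedule

/-! ### The combined algorithm and its competitive ratio -/

section Combined

variable {σ : List (Request n)} {init f : Assignment n ℓ} {ε : ℝ}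

open Classical in
lemma combined_run {t : ℕ} (ht : t ≤ σ.length) : (combined n ℓ ε).run init σ t =
    if ∀ k ≤ t, UnitCapacity ε (lazyRun init (σ.take k)) then lazyRun init (σ.take t)
    else rebalanceRun ε init (σ.take t) := by
  unfold OnlineAlgorithm.run combined
  refine if_congr ?_ rfl rfl
  rw [List.length_take, min_eq_left ht]
  refine forall₂_congr fun k hk => ?_
  rw [List.take_take, min_eq_left hk]

lemma respects_combined (hσ : IsRequestSequence ℓ σ) {t : ℕ} (ht : t ≤ σ.length) :
    Respects (rep (σ.take t)) ((combined n ℓ ε).run init σ t) := by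
  obtain ⟨f, hf⟩ := hσ.exists_isTarget
  rw [combined_run ht]
  split_ifs
  · exact respects_lazyRun hσ ht
  · exact respects_rebalanceRun hσ hf ht

lemma isSchedule_combined (hσ : IsRequestSequence ℓ σ) (hε : 0 ≤ ε)
    (hinit : UnitCapacity ε init) :
    IsSchedule ε init σ ((combined n ℓ ε).run init σ) := by
  obtain ⟨f, hf⟩ := hσ.exists_isTarget
  refine isSchedule_of_respects hσ ?_ (fun t ht => respects_combined hσ ht) fun t ht => ?_
  · rw [combined_run (Nat.zero_le _)]
    split_ifs <;> rfl
  · rw [combined_run ht]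
    split_ifs with h
    · exact h t le_rfl
    · exact unitCapacity_rebalanceRun hf hε hinit ht

open Classical in
-- The rebalancing run is simulated from the start, so its full cost is charged once it takes over.
-- The switch happens at most once and moves at most all n units.
lemma combined_cost_le {t : ℕ} (ht : t ≤ σ.length) :
    ∑ k ∈ range t, hammingDist ((combined n ℓ ε).run init σ k)
        ((combined n ℓ ε).run init σ (k + 1)) ≤
      ∑ k ∈ range t, hammingDist (lazyRun init (σ.take k)) (lazyRun init (σ.take (k + 1))) +
      if ∀ k ≤ t, UnitCapacity ε (lazyRun init (σ.take k)) then 0 else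
        n + ∑ k ∈ range t, hammingDist (rebalanceRun ε init (σ.take k))
          (rebalanceRun ε init (σ.take (k + 1))) := by
  induction t with
  | zero => simp
  | succ t ih =>
    have ih := ih (by omega)
    rw [sum_range_succ, sum_range_succ, sum_range_succ, combined_run ht,
      combined_run (show t ≤ σ.length by omega)]
    by_cases h1 : ∀ k ≤ t + 1, UnitCapacity ε (lazyRun init (σ.take k))
    · have h0 : ∀ k ≤ t, UnitCapacity ε (lazyRun init (σ.take k)) := fun k hk => h1 k (by omega)
      rw [if_pos h0] at ih ⊢
      rw [if_pos h1, if_pos h1]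
      omega
    · rw [if_neg h1, if_neg h1]
      split_ifs at ih ⊢ with h0
      · have := hammingDist_le_card_fintype (x := lazyRun init (σ.take t))
          (y := rebalanceRun ε init (σ.take (t + 1)))
        rw [Fintype.card_fin] at this
        omega
      · omega

end Combined

/-- In multiples of (ℓ/ε) Δ log n, the lazy run contributes 12, the switch 5, the rebalancings 4 and
the merges 10, which is below 40. -/
theorem combined_isCompetitive {ε : ℝ} (hn : 0 < n) (hℓ : 2 ≤ ℓ) (hε : 0 < ε) (hε1 : ε < 1 / 2) :
    IsCompetitive ε (combined n ℓ ε)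
      (40 * ((ℓ : ℝ) * Real.logb 2 n * Real.logb 2 ℓ / ε)) := by
  classical
  intro init hinit σ hσ
  have hinit : UnitCapacity ε init := by
    have := (hσ.withinCapacity_iff (ε := ε) (Nat.zero_le _) (a := init)
      (by simpa using respects_id init)).1
    exact this (by simpa [valuesAfter] using hinit)
  have hS := isSchedule_combined hσ hε.le hinit
  refine ⟨hS, ?_⟩
  obtain ⟨a, ha, hcost⟩ : offlineCost ε init σ ∈
      {c | ∃ a : ℕ → Assignment n ℓ, IsSchedule ε init σ a ∧ scheduleCost σ a = c} :=
    Nat.sInf_mem ⟨_, _, hS, rfl⟩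
  obtain ⟨f, hf, hD⟩ := ha.exists_isTarget hσ hn (by omega) (by linarith)
  rw [hcost] at hD
  have hD' : (hammingDist init f : ℝ) ≤ offlineCost ε init σ := by exact_mod_cast hD
  rw [scheduleCost_of_respects hσ (fun t ht => respects_combined hσ ht)]
  have hc := combined_cost_le (ε := ε) (init := init) (σ := σ) le_rfl
  have hlazy := lazyRun_cost_le (init := init) hσ hf
  have hℓn : ℓ ≤ n := by
    have := card_le_univ (univ.filter (fun i => 0 < valuesAfter σ i))
    rwa [hσ.final_card, Fintype.card_fin] at this
  have hℓ2 : (2 : ℝ) ≤ ℓ := by exact_mod_cast hℓ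
  have hn2 : (2 : ℝ) ≤ n := by exact_mod_cast hℓ.trans hℓn
  have hlogℓ : 1 ≤ Real.logb 2 ℓ := by
    rw [Real.le_logb_iff_rpow_le (by norm_num) (by linarith)]
    simpa using hℓ2
  have hlogn : 1 ≤ Real.logb 2 n := by
    rw [Real.le_logb_iff_rpow_le (by norm_num) (by linarith)]
    simpa using hn2
  set Δ : ℝ := ((hammingDist init f : ℕ) : ℝ)
  set L := Real.logb 2 n
  have hΔ : 0 ≤ Δ := by positivity
  have hK : 1 ≤ (ℓ : ℝ) / ε := by
    rw [le_div_iff₀ hε]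
    linarith
  have hmain : ((∑ t ∈ range σ.length, hammingDist ((combined n ℓ ε).run init σ t)
      ((combined n ℓ ε).run init σ (t + 1)) : ℕ) : ℝ) ≤ 40 * (ℓ / ε * L * Δ) := by
    have hLΔ0 : 0 ≤ L * Δ := mul_nonneg (by linarith) hΔ
    have hLΔ : L * Δ ≤ ℓ / ε * L * Δ := by nlinarith
    have hcR := (Nat.cast_le (α := ℝ)).2 hc
    split_ifs at hcR with hQ
    · push_cast at hcR ⊢
      linarith
    · push_cast at hcR ⊢
      -- The switch certifies that Δ is large, which makes n comparable to Δℓ/ε.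
      have hviol : ε * n / ℓ < 5 * Δ := by
        push Not at hQ
        obtain ⟨k, hk, hk'⟩ := hQ
        unfold UnitCapacity at hk'
        push Not at hk'
        obtain ⟨b, hb⟩ := hk'
        have h1 := unitLoad_lazyRun_le (init := init) hf hk b
        have e : (1 + ε) * n / ℓ = n / ℓ + ε * n / ℓ := by ring
        linarith
      have hs : 0 < ε * n / ℓ := by positivity
      have hnΔ : (n : ℝ) ≤ 5 * (ℓ / ε * Δ) := by
        have e : (n : ℝ) = ℓ / ε * (ε * n / ℓ) := by field_simp
        calc (n : ℝ) = ℓ / ε * (ε * n / ℓ) := e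
          _ ≤ ℓ / ε * (5 * Δ) := by gcongr
          _ = _ := by ring
      obtain ⟨R, h1, h2, -⟩ := exists_rebalanceRun_bound hσ hf hε.le hinit le_rfl
      have hV := potential_le univ (rep (σ.take σ.length))
      rw [card_univ, Fintype.card_fin] at hV
      have hR : (R : ℝ) ≤ ℓ / ε * L + 1 := by
        have e : (ℓ / ε * L + 1) * (ε * n / ℓ) = n * L + ε * n / ℓ := by field_simp
        refine le_of_mul_le_mul_right ?_ hs
        rw [e]
        linarith
      have hpos : (0 : ℝ) ≤ hammingDist (rebalanceRun ε init (σ.take σ.length)) init := by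
        positivity
      have hRΔ : 2 * Δ * R ≤ 2 * (ℓ / ε * L * Δ) + 2 * Δ := by nlinarith
      have hKL : ℓ / ε * Δ ≤ ℓ / ε * L * Δ := by
        have : 0 ≤ ℓ / ε * Δ := by positivity
        nlinarith
      have hΔK : Δ ≤ L * Δ := by nlinarith
      have hnL : n * L ≤ 5 * (ℓ / ε * L * Δ) := by nlinarith
      linarith
  refine hmain.trans ?_
  have e : 40 * ((ℓ : ℝ) * L * Real.logb 2 ℓ / ε) * (offlineCost ε init σ : ℝ) =
      40 * (ℓ / ε * L * offlineCost ε init σ * Real.logb 2 ℓ) := by ring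
  rw [e]
  have h1 : (ℓ : ℝ) / ε * L * Δ ≤ ℓ / ε * L * offlineCost ε init σ := by gcongr
  have h2 : (0 : ℝ) ≤ ℓ / ε * L * offlineCost ε init σ := by positivity
  nlinarith

/-- With a single bin nothing is ever moved. -/
lemma scheduleCost_eq_zero_of_subsingleton [Subsingleton (Fin ℓ)] (σ : List (Request n))
    (a : ℕ → Assignment n ℓ) : scheduleCost σ a = 0 := by
  refine sum_eq_zero fun t _ => ?_
  rw [Subsingleton.elim (a t) (a (t + 1))]
  simp [moveCost]

end OnlineKWay

theorem mainTheorem7 :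
    ∃ C : ℝ, 0 < C ∧ ∀ (n ℓ : ℕ) (ε : ℝ), 0 < ℓ → 0 < ε → ε < 1 / 2 →
      ∃ A : OnlineKWay.OnlineAlgorithm n ℓ,
        OnlineKWay.IsCompetitive ε A
          (C * ((ℓ : ℝ) * Real.logb 2 n * Real.logb 2 ℓ / ε)) := by
  refine ⟨40, by norm_num, fun n ℓ ε hℓ hε hε1 => ⟨OnlineKWay.combined n ℓ ε, ?_⟩⟩
  -- For ℓ = 1 the bound vanishes with log ℓ, so the cost must be exactly 0.
  rcases Nat.lt_or_ge ℓ 2 with h | h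
  · obtain rfl : ℓ = 1 := by omega
    intro init hinit σ hσ
    refine ⟨OnlineKWay.isSchedule_combined hσ hε.le ?_, ?_⟩
    · exact (hσ.withinCapacity_iff (ε := ε) (Nat.zero_le _) (a := init)
        (by simpa using OnlineKWay.respects_id init)).1
        (by simpa [OnlineKWay.valuesAfter] using hinit)
    · simp [OnlineKWay.scheduleCost_eq_zero_of_subsingleton]
  · rcases Nat.eq_zero_or_pos n with rfl | hn
    · intro init _ σ hσ
      have := hσ.final_card
      simp at this
      omega
    · exact OnlineKWay.combined_isCompetitive hn h hε hε1
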